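/- Let $\mathbb K$ be a field of characteristic zero and $n\ge 0$. Let $S=\mathbb K[p_1,q_1,\dots,p_n,q_n]=\bigoplus_{k\ge0}S^k$ be the polynomial algebra graded by degree, $m\colon S\otimes S\to S$ its commutative product, and define $\wp\colon S\otimes S\to S\otimes S$ by $$\wp(F\otimes G)=\sum_{i=1}^n\Big(\frac{\partial F}{\partial p_i}\otimes\frac{\partial G}{\partial q_i}-\frac{\partial F}{\partial q_i}\otimes\frac{\partial G}{\partial p_i}\Big).$$ Let $W$ be the Weyl algebra, realized as the space $S$ with the Moyal product $$F\star G=\sum_{k\ge0}\frac{1}{2^k k!}\,m\big(\wp^k(F\otimes G)\big)$$ (a finite sum for each $F,G$). Put $\kappa(F,G)=(F\star G)(0)$ for $F,G\in W$. Let $\mathrm{ad}'\colon W\times W\to W$ (the twisted adjoint action) and $B\colon W\times W\to\mathbb K$ be the bilinear maps such that, for all $F\in S^f$ and $G\in S^g$, $$\mathrm{ad}'(F)(G)=F\star G-(-1)^{f(g+1)}\,G\star F,\qquad B(F,G)=(-1)^{fg+1}\kappa(F,G).$$ A bilinear form $b$ on $W$ is called $\mathrm{ad}'$-invariant if $b(\mathrm{ad}'(A)(F),G)+(-1)^{af}\,b(F,\mathrm{ad}'(A)(G))=0$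 for all $a,f\ge 0$, $A\in S^a$, $F\in S^f$ and $G\in W$. Theorem. The form $B$ is non-degenerate and supersymmetric, i.e. $B(F,G)=(-1)^{fg}B(G,F)$ for all $F\in S^f$, $G\in S^g$. Moreover $B(S^\ell,S^m)=\{0\}$ if $\ell\ne m$, the restriction of $B$ to $S^\ell\times S^\ell$ is non-degenerate for every $\ell\ge0$, and $B$ is $\mathrm{ad}'$-invariant. If $B'$ is any $\mathrm{ad}'$-invariant bilinear form on $W$, then there exists $\beta\in\mathbb K$ such that $B'=\beta B$. -/

import Mathlib

noncomputable section

namespace Moyal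

open scoped TensorProduct
open MvPolynomial

variable (K : Type*) [Field K] (n : ℕ)

/-- The commutative polynomial algebra `S = K[p_1, q_1, …, p_n, q_n]`; the variable `Sum.inl i` is
`p_i` and the variable `Sum.inr i` is `q_i`. Together with the product `Moyal.star` below it is
the Weyl algebra `W`. -/
abbrev Poly : Type _ := MvPolynomial (Fin n ⊕ Fin n) K

/-- The homogeneous part `S^k` of degree `k` (with respect to the commutative product). -/
abbrev homPart (k : ℕ) : Submodule K (Poly K n) := homogeneousSubmodule (Fin n ⊕ Fin n) K k

/-- `∂/∂p_i` as a linear map. -/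
def dp (i : Fin n) : Poly K n →ₗ[K] Poly K n := (pderiv (R := K) (Sum.inl i : Fin n ⊕ Fin n)).toLinearMap

/-- `∂/∂q_i` as a linear map. -/
def dq (i : Fin n) : Poly K n →ₗ[K] Poly K n := (pderiv (R := K) (Sum.inr i : Fin n ⊕ Fin n)).toLinearMap

/-- The operator `℘(F ⊗ G) = ∑ i, (∂F/∂p_i ⊗ ∂G/∂q_i - ∂F/∂q_i ⊗ ∂G/∂p_i)` on `S ⊗ S`. -/
def poissonOp : (Poly K n ⊗[K] Poly K n) →ₗ[K] (Poly K n ⊗[K] Poly K n) :=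
  ∑ i : Fin n, (TensorProduct.map (dp K n i) (dq K n i) - TensorProduct.map (dq K n i) (dp K n i))

/-- The bidifferential operators `C_k(F, G) = (1 / (2^k k!)) m(℘^k(F ⊗ G))`, where `m` is the
commutative product. -/
def moyalC (k : ℕ) : Poly K n →ₗ[K] Poly K n →ₗ[K] Poly K n :=
  ((2 ^ k * (k.factorial : K))⁻¹) •
    (TensorProduct.mk K (Poly K n) (Poly K n)).compr₂
      (LinearMap.mul' K (Poly K n) ∘ₗ (poissonOp K n) ^ k)

variable {K n}

lemma moyalC_apply (k : ℕ) (F G : Poly K n) : moyalC K n k F G =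
    ((2 ^ k * (k.factorial : K))⁻¹) • LinearMap.mul' K (Poly K n) ((poissonOp K n ^ k) (F ⊗ₜ[K] G)) :=
  rfl

lemma poissonOp_tmul (F G : Poly K n) : poissonOp K n (F ⊗ₜ[K] G) =
    ∑ i : Fin n, (pderiv (Sum.inl i) F ⊗ₜ[K] pderiv (Sum.inr i) G
      - pderiv (Sum.inr i) F ⊗ₜ[K] pderiv (Sum.inl i) G) := by
  simp [poissonOp, dp, dq]

lemma poissonOp_pow_eq_zero (d : ℕ) : ∀ (k : ℕ) (F G : Poly K n), F.IsHomogeneous d → d < k →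
    (poissonOp K n ^ k) (F ⊗ₜ[K] G) = 0 := by
  induction d with
  | zero =>
    intro k F G hF hk
    obtain ⟨k, rfl⟩ := Nat.exists_eq_succ_of_ne_zero hk.ne'
    have h0 : ∀ i, pderiv i F = 0 := fun i => by
      rw [totalDegree_eq_zero_iff_eq_C.mp ((totalDegree_zero_iff_isHomogeneous _).mpr hF)]
      simp
    rw [pow_succ, Module.End.mul_apply, poissonOp_tmul]
    simp [h0]
  | succ d ih =>
    intro k F G hF hk
    obtain ⟨k, rfl⟩ := Nat.exists_eq_succ_of_ne_zero (Nat.ne_of_gt (Nat.zero_lt_of_lt hk))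
    have h1 : ∀ i (G : Poly K n), (poissonOp K n ^ k) (pderiv i F ⊗ₜ[K] G) = 0 :=
      fun i G => ih k _ G (by simpa using hF.pderiv (i := i)) (by omega)
    rw [pow_succ, Module.End.mul_apply, poissonOp_tmul]
    simp [h1]

lemma moyalC_eq_zero_of_lt (k : ℕ) (F G : Poly K n) (h : F.totalDegree < k) : moyalC K n k F G = 0 := by
  rw [moyalC_apply, ← sum_homogeneousComponent F, TensorProduct.sum_tmul, map_sum,
    Finset.sum_eq_zero, map_zero, smul_zero]
  intro i hi
  rw [Finset.mem_range] at hi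
  exact poissonOp_pow_eq_zero i k _ G (homogeneousComponent_isHomogeneous i F) (by omega)

lemma moyalC_support_finite (F G : Poly K n) : (Function.support fun k => moyalC K n k F G).Finite := by
  refine (Set.finite_Iic F.totalDegree).subset fun k hk => ?_
  by_contra hlt
  exact hk (moyalC_eq_zero_of_lt k F G (by simpa using hlt))

variable (K n)

/-- The Moyal star product `F ⋆ G = ∑_{k ≥ 0} C_k(F, G)` (with parameter `t = 1`), as a bilinear
map. The sum has finite support by `moyalC_support_finite`. -/
def star : Poly K n →ₗ[K] Poly K n →ₗ[K] Poly K n :=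
  LinearMap.mk₂ K (fun F G => ∑ᶠ k, moyalC K n k F G)
    (fun F F' G => by
      simp only [map_add, LinearMap.add_apply]
      exact finsum_add_distrib (moyalC_support_finite F G) (moyalC_support_finite F' G))
    (fun c F G => by
      simp only [map_smul, LinearMap.smul_apply]
      exact (smul_finsum' c (moyalC_support_finite F G)).symm)
    (fun F G G' => by
      simp only [map_add]
      exact finsum_add_distrib (moyalC_support_finite F G) (moyalC_support_finite F G'))
    (fun c F G => by
      simp only [map_smul]
      exact (smul_finsum' c (moyalC_support_finite F G)).symm)

/-- The supertrace `Str(F) = F(0)`. -/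
def str : Poly K n →ₗ[K] K := (aeval (R := K) (fun _ : Fin n ⊕ Fin n => (0 : K))).toLinearMap

/-- The bilinear form `κ(F, G) = Str(F ⋆ G)`. -/
def kappa : LinearMap.BilinForm K (Poly K n) := (star K n).compr₂ (str K n)

variable {K n}

/-- Given a bilinear map `b` on `S` and signs `s f g`, the unique bilinear map whose value is
`s f g • b F G` for all `F ∈ S^f`, `G ∈ S^g` (see `twist_apply`); it is defined on the basis of
monomials. -/
def twist {M : Type*} [AddCommGroup M] [Module K M] (s : ℕ → ℕ → K)
    (b : Poly K n →ₗ[K] Poly K n →ₗ[K] M) : Poly K n →ₗ[K] Poly K n →ₗ[K] M :=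
  (basisMonomials (Fin n ⊕ Fin n) K).constr K fun u =>
    (basisMonomials (Fin n ⊕ Fin n) K).constr K fun v =>
      s u.degree v.degree • b (monomial u 1) (monomial v 1)

lemma twist_monomial {M : Type*} [AddCommGroup M] [Module K M] (s : ℕ → ℕ → K)
    (b : Poly K n →ₗ[K] Poly K n →ₗ[K] M) (u v : Fin n ⊕ Fin n →₀ ℕ) :
    twist s b (monomial u 1) (monomial v 1) =
      s u.degree v.degree • b (monomial u 1) (monomial v 1) := by
  have h : ∀ w : Fin n ⊕ Fin n →₀ ℕ, (monomial w 1 : Poly K n) = basisMonomials _ K w := by simp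
  conv_lhs => rw [h u, h v]
  rw [twist, Module.Basis.constr_basis, Module.Basis.constr_basis]

lemma twist_apply {M : Type*} [AddCommGroup M] [Module K M] (s : ℕ → ℕ → K)
    (b : Poly K n →ₗ[K] Poly K n →ₗ[K] M) {f g : ℕ} {F G : Poly K n}
    (hF : F ∈ homPart K n f) (hG : G ∈ homPart K n g) : twist s b F G = s f g • b F G := by
  have h : ∀ (d : ℕ) (H : Poly K n), H ∈ homPart K n d →
      ∃ (T : Finset (Fin n ⊕ Fin n →₀ ℕ)) (c : (Fin n ⊕ Fin n →₀ ℕ) → K),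
        (∀ u ∈ T, u.degree = d) ∧ H = ∑ u ∈ T, c u • monomial u 1 := by
    intro d H hH
    refine ⟨H.support, fun u => H.coeff u, fun u hu => ?_, ?_⟩
    · have := hH (mem_support_iff.mp hu)
      rwa [Finsupp.degree_eq_weight_one]
    · simp [smul_monomial]
  obtain ⟨T, c, hT, rfl⟩ := h f F hF
  obtain ⟨U, e, hU, rfl⟩ := h g G hG
  simp only [map_sum, map_smul, LinearMap.sum_apply, LinearMap.smul_apply, Finset.smul_sum]
  refine Finset.sum_congr rfl fun u hu => Finset.sum_congr rfl fun v hv => ?_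
  rw [twist_monomial, hT v hv, hU u hu]
  simp only [smul_smul]
  congr 1
  ring

variable (K n)

/-- The twisted adjoint action: the bilinear extension of
`ad'(F)(G) = F ⋆ G - (-1)^{f(g+1)} G ⋆ F` for `F ∈ S^f`, `G ∈ S^g`. -/
def adTwisted : Poly K n →ₗ[K] Poly K n →ₗ[K] Poly K n :=
  star K n - twist (fun f g => (-1) ^ (f * (g + 1))) (star K n).flip

/-- The bilinear form `B`: the bilinear extension of `B(F, G) = (-1)^{fg+1} κ(F, G)` for
`F ∈ S^f`, `G ∈ S^g`. -/
def formB : LinearMap.BilinForm K (Poly K n) :=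
  twist (fun f g => (-1) ^ (f * g + 1)) (kappa K n)

variable {K n}

lemma star_apply (F G : Poly K n) : star K n F G = ∑ᶠ k, moyalC K n k F G := rfl

lemma adTwisted_apply {f g : ℕ} {F G : Poly K n} (hF : F ∈ homPart K n f) (hG : G ∈ homPart K n g) :
    adTwisted K n F G = star K n F G - (-1 : K) ^ (f * (g + 1)) • star K n G F := by
  rw [adTwisted, LinearMap.sub_apply, LinearMap.sub_apply, twist_apply _ _ hF hG,
    LinearMap.flip_apply]

lemma formB_apply {f g : ℕ} {F G : Poly K n} (hF : F ∈ homPart K n f) (hG : G ∈ homPart K n g) :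
    formB K n F G = (-1) ^ (f * g + 1) * kappa K n F G := by
  rw [formB, twist_apply _ _ hF hG, smul_eq_mul]

/-- A bilinear form `b` on `W` is supersymmetric if `b(F, G) = (-1)^{fg} b(G, F)` for `F ∈ S^f`,
`G ∈ S^g`. -/
def IsSupersymmetric (b : LinearMap.BilinForm K (Poly K n)) : Prop :=
  ∀ (f g : ℕ) (F G : Poly K n), F ∈ homPart K n f → G ∈ homPart K n g →
    b F G = (-1) ^ (f * g) * b G F

/-- A bilinear form `b` on `W` is `ad'`-invariant if
`b(ad'(A)(F), G) + (-1)^{af} b(F, ad'(A)(G)) = 0` for `A ∈ S^a`, `F ∈ S^f` and all `G ∈ W`. -/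
def IsAdTwistedInvariant (b : LinearMap.BilinForm K (Poly K n)) : Prop :=
  ∀ (a f : ℕ) (A F G : Poly K n), A ∈ homPart K n a → F ∈ homPart K n f →
    b (adTwisted K n A F) G + (-1) ^ (a * f) * b F (adTwisted K n A G) = 0

end Moyal

end

/-!
The proof rests on the action of the generators `x` of `S`. Let `∂_x = {x, ·}` be the Hamiltonian
derivation of `x`; it is a partial derivative up to sign. The commutator of `℘` with multiplication
by `x` on the left factor is `∂_x` on the right factor, and commutes with `℘`. Hence
`(x F) ⋆ G = x (F ⋆ G) + 1/2 F ⋆ ∂_x G` (`star_X_mul`). This formula determines the product, and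
induction on `F` with it gives that each `∂_x` is a derivation of `⋆` (`ham_star`), that `⋆` is
associative (`star_assoc`), the mirror formula for `F ⋆ (x G)` (`star_mul_X`), and compatibility of
`⋆` with the parity automorphism `ε`, which is `(-1)^f` on `S^f` (`parity_star`).

Evaluation at `0` turns these formulas into `κ(x F, G) = 1/2 κ(F, ∂_x G)` and
`κ(F, x G) = -1/2 κ(∂_x F, G)`. Therefore `κ(ε F, G) = κ(G, F)`, the form `κ` vanishes on
`S^f × S^g` for `f ≠ g`, and its kernel is stable under all partial derivatives, so that Euler's
identity and induction on the degree show that it is zero. By orthogonality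
`B(F, G) = -κ(ε F, G)`, from which the properties of `B` follow; invariance is associativity together
with `κ(ε F, G) = κ(G, F)`.

For uniqueness, an `ad'`-invariant form `b` with `b(1, 1) = 0` is zero. Indeed `ad'(A)(1) = 0` for `A`
even, so `b(1, ·)` kills `ad'(x^2)(G) = 2 x ∂_x G`; these elements span the polynomials without
constant term, and so `b(1, ·) = 0`. For `A` odd, `ad'(A)(1) = 2 A`, whence `b(A, ·) = 0` by
invariance. Every nonconstant even monomial is `∂_x F = ad'(x)(F)` with `F` odd, and invariance
finishes the argument. The general case follows by subtracting a multiple of `B`.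
-/

noncomputable section

namespace Moyal

open scoped TensorProduct
open MvPolynomial

variable {K : Type*} [Field K] {n : ℕ}

section

/-! ### Hamiltonian derivations of the generators -/

/-- The Hamiltonian derivation `{x, ·}` of the generator `x = X s`, that is `∂/∂q_i` for `x = p_i`
and `-∂/∂p_i` for `x = q_i`. -/
def ham (s : Fin n ⊕ Fin n) : Derivation K (Poly K n) (Poly K n) :=
  Sum.elim (fun i => pderiv (Sum.inr i)) (fun i => -pderiv (Sum.inl i)) s

@[simp] lemma ham_inl (i : Fin n) : ham (K := K) (Sum.inl i) = pderiv (Sum.inr i) := rfl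

@[simp] lemma ham_inr (i : Fin n) : ham (K := K) (Sum.inr i) = -pderiv (Sum.inl i) := rfl

lemma pderiv_comm {σ R : Type*} [CommRing R] (i j : σ) (F : MvPolynomial σ R) :
    pderiv i (pderiv j F) = pderiv j (pderiv i F) := by
  classical
  have h : ⁅pderiv (R := R) i, pderiv (R := R) j⁆ = 0 := by
    refine MvPolynomial.derivation_ext fun k => ?_
    simp [Derivation.commutator_apply, Pi.single_apply, apply_ite]
  have := congrArg (fun D : Derivation R (MvPolynomial σ R) (MvPolynomial σ R) => D F) h
  simpa [Derivation.commutator_apply, sub_eq_zero] using this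

lemma pderiv_ham (i s : Fin n ⊕ Fin n) (F : Poly K n) :
    pderiv i (ham s F) = ham s (pderiv i F) := by
  rcases s with j | j <;> simp [pderiv_comm i]

lemma ham_comm (s t : Fin n ⊕ Fin n) (F : Poly K n) : ham s (ham t F) = ham t (ham s F) := by
  rcases s with j | j <;> simp [pderiv_ham]

/-- The Poisson bracket of two generators is a constant. -/
lemma exists_ham_X_eq_C (s t : Fin n ⊕ Fin n) : ∃ c : K, ham s (X t) = C c := by
  classical
  rcases s with i | i
  · exact ⟨if Sum.inr i = t then 1 else 0, by simp [Pi.single_apply, apply_ite C, eq_comm]⟩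
  · exact ⟨if Sum.inl i = t then -1 else 0, by
      by_cases h : t = Sum.inl i <;> simp [h, eq_comm]⟩

lemma ham_X_antisymm (s t : Fin n ⊕ Fin n) : ham (K := K) s (X t) = -ham t (X s) := by
  classical
  rcases s with i | i <;> rcases t with j | j <;> by_cases h : i = j <;>
    simp [h, eq_comm, Ne.symm]

lemma ham_X_mul (s t : Fin n ⊕ Fin n) (F : Poly K n) :
    ham s (X t * F) = ham s (X t) * F + X t * ham s F := by
  rw [Derivation.leibniz, smul_eq_mul, smul_eq_mul]; ring

lemma ham_mem_homPart {f : ℕ} {F : Poly K n} (hF : F ∈ homPart K n f) (s : Fin n ⊕ Fin n) :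
    ham s F ∈ homPart K n (f - 1) := by
  rcases s with i | i
  · exact IsHomogeneous.pderiv hF
  · exact neg_mem (IsHomogeneous.pderiv (i := Sum.inl i) hF)

/-! ### The Moyal product with a generator -/

/-- The commutator of `℘` with `x ⊗ 1` is `1 ⊗ {x, ·}`. -/
lemma poissonOp_X_mul (s : Fin n ⊕ Fin n) (F G : Poly K n) :
    poissonOp K n ((X s * F) ⊗ₜ[K] G) =
      TensorProduct.map (LinearMap.mulLeft K (X s)) LinearMap.id (poissonOp K n (F ⊗ₜ[K] G)) +
        F ⊗ₜ[K] ham s G := by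
  classical
  simp only [poissonOp_tmul, pderiv_mul, map_sum, map_sub, TensorProduct.map_tmul,
    LinearMap.mulLeft_apply, LinearMap.id_apply, TensorProduct.add_tmul, pderiv_X]
  have e : ∀ a b c d : Poly K n ⊗[K] Poly K n, a + b - (c + d) = (b - d) + (a - c) := by
    intros; abel
  simp only [e, Finset.sum_add_distrib, add_right_inj]
  rcases s with j | j
  · simp only [Pi.single_apply, Sum.inl.injEq, reduceCtorEq, if_false, zero_mul,
      TensorProduct.zero_tmul, sub_zero, ham_inl]
    rw [Finset.sum_eq_single j] <;> simp +contextual [eq_comm]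
  · simp only [Pi.single_apply, Sum.inr.injEq, reduceCtorEq, if_false, zero_mul,
      TensorProduct.zero_tmul, zero_sub, ham_inr]
    rw [Finset.sum_eq_single j] <;> simp +contextual [eq_comm, TensorProduct.tmul_neg]

lemma poissonOp_comp_mulLeft (s : Fin n ⊕ Fin n) :
    poissonOp K n * TensorProduct.map (LinearMap.mulLeft K (X s)) LinearMap.id =
      TensorProduct.map (LinearMap.mulLeft K (X s)) LinearMap.id * poissonOp K n +
        TensorProduct.map LinearMap.id (ham s).toLinearMap :=
  TensorProduct.ext' fun F G => by simp [poissonOp_X_mul]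

lemma commute_poissonOp_ham (s : Fin n ⊕ Fin n) :
    Commute (poissonOp K n) (TensorProduct.map LinearMap.id (ham s).toLinearMap) :=
  TensorProduct.ext' fun F G => by simp [poissonOp_tmul, pderiv_ham]

/-- If `[P, M] = N` and `N` commutes with `P`, then `[P ^ (k + 1), M] = (k + 1) N P ^ k`. -/
lemma pow_succ_mul_of_commutator {A : Type*} [Ring A] {P M N : A} (h : P * M = M * P + N)
    (hN : Commute P N) (k : ℕ) : P ^ (k + 1) * M = M * P ^ (k + 1) + (k + 1 : ℕ) * (P ^ k * N) := by
  induction k with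
  | zero => simpa using h
  | succ k ih =>
    rw [pow_succ', mul_assoc, ih, mul_add, ← mul_assoc, h, add_mul, mul_assoc M, ← pow_succ',
      ← (hN.pow_left (k + 1)).eq, (Nat.cast_commute (k + 1) P).symm.left_comm, ← mul_assoc P,
      ← pow_succ', Nat.cast_succ (k + 1)]
    noncomm_ring

lemma moyalC_zero (F G : Poly K n) : moyalC K n 0 F G = F * G := by
  simp [moyalC_apply]

lemma star_eq_sum {N : ℕ} (F G : Poly K n) (h : F.totalDegree < N) :
    star K n F G = ∑ k ∈ Finset.range N, moyalC K n k F G := by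
  rw [star_apply]
  refine finsum_eq_sum_of_support_subset _ fun k hk => ?_
  by_contra hlt
  exact hk (moyalC_eq_zero_of_lt k F G (by simp at hlt; omega))

lemma star_C (c : K) (G : Poly K n) : star K n (C c) G = c • G := by
  rw [star_eq_sum (N := 1) _ _ (by simp)]
  simp [moyalC_zero, C_mul']

lemma one_star (G : Poly K n) : star K n 1 G = G := by
  simpa using star_C 1 G

variable [CharZero K]

lemma moyalC_succ_X_mul (k : ℕ) (s : Fin n ⊕ Fin n) (F G : Poly K n) :
    moyalC K n (k + 1) (X s * F) G =
      X s * moyalC K n (k + 1) F G + (2⁻¹ : K) • moyalC K n k F (ham s G) := by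
  have h := LinearMap.congr_fun
    (pow_succ_mul_of_commutator (A := Module.End K (Poly K n ⊗[K] Poly K n))
      (poissonOp_comp_mulLeft (K := K) s) (commute_poissonOp_ham (K := K) s) k)
    (F ⊗ₜ[K] G)
  have hM : ∀ T : Poly K n ⊗[K] Poly K n, LinearMap.mul' K (Poly K n)
      (TensorProduct.map (LinearMap.mulLeft K (X s)) LinearMap.id T) =
        X s * LinearMap.mul' K (Poly K n) T := by
    intro T
    induction T with
    | zero => simp
    | tmul a b => simp [mul_assoc]
    | add a b ha hb => simp only [map_add, ha, hb, mul_add]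
  simp only [← nsmul_eq_mul, LinearMap.add_apply, LinearMap.smul_apply, Module.End.mul_apply,
    TensorProduct.map_tmul, LinearMap.mulLeft_apply, LinearMap.id_apply,
    Derivation.coeFn_coe] at h
  simp only [moyalC_apply, h, map_add, hM, map_smul, smul_add, mul_smul_comm, smul_smul,
    ← Nat.cast_smul_eq_nsmul K (k + 1)]
  congr 2
  have h1 : (k.factorial : K) ≠ 0 := by exact_mod_cast k.factorial_ne_zero
  have h2 : ((k + 1 : ℕ) : K) ≠ 0 := by exact_mod_cast k.succ_ne_zero
  rw [Nat.factorial_succ]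
  push_cast at h2 ⊢
  field_simp
  ring

/-- Together with `star_C` this determines the Moyal product by recursion on the left factor. -/
lemma star_X_mul (s : Fin n ⊕ Fin n) (F G : Poly K n) :
    star K n (X s * F) G = X s * star K n F G + (2⁻¹ : K) • star K n F (ham s G) := by
  have h1 : (X s * F).totalDegree < F.totalDegree + 2 := by
    have := totalDegree_mul (X s) F
    rw [totalDegree_X] at this
    omega
  rw [star_eq_sum _ _ h1, star_eq_sum F G (N := F.totalDegree + 2) (by omega),
    star_eq_sum F (ham s G) (Nat.lt_succ_self _), Finset.sum_range_succ',
    Finset.sum_range_succ' (fun k => moyalC K n k F G)]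
  simp only [moyalC_succ_X_mul, moyalC_zero, Finset.sum_add_distrib, Finset.smul_sum, mul_add,
    Finset.mul_sum]
  ring

lemma ham_star (t : Fin n ⊕ Fin n) (F G : Poly K n) :
    ham t (star K n F G) = star K n (ham t F) G + star K n F (ham t G) := by
  induction F using MvPolynomial.induction_on generalizing G with
  | C a => simp [star_C]
  | add F F' hF hF' => simp only [map_add, LinearMap.add_apply, hF, hF']; abel
  | mul_X F s ih =>
    obtain ⟨c, hc⟩ := exists_ham_X_eq_C (K := K) t s
    rw [mul_comm F, star_X_mul, map_add, ham_X_mul, hc, Derivation.map_smul, ih, ih, ham_X_mul, hc,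
      C_mul', C_mul', map_add, map_smul, LinearMap.add_apply, LinearMap.smul_apply, star_X_mul,
      star_X_mul, ham_comm t s]
    simp only [mul_add, smul_add]
    abel

lemma star_assoc (F G H : Poly K n) : star K n (star K n F G) H = star K n F (star K n G H) := by
  induction F using MvPolynomial.induction_on generalizing G H with
  | C a => simp [star_C]
  | add F F' hF hF' => simp only [map_add, LinearMap.add_apply, hF, hF']
  | mul_X F s ih =>
    simp only [mul_comm F, star_X_mul, ham_star, map_add, map_smul, LinearMap.add_apply,
      LinearMap.smul_apply, ih]
    simp only [smul_add]
    abel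

lemma star_mul_X (s : Fin n ⊕ Fin n) (F G : Poly K n) :
    star K n F (X s * G) = X s * star K n F G - (2⁻¹ : K) • star K n (ham s F) G := by
  induction F using MvPolynomial.induction_on generalizing G with
  | C a => simp [star_C]
  | add F F' hF hF' => simp only [map_add, LinearMap.add_apply, hF, hF', mul_add, smul_add]; abel
  | mul_X F t ih =>
    obtain ⟨c, hc⟩ := exists_ham_X_eq_C (K := K) s t
    have hc' : ham t (X s) = C (-c) := by rw [ham_X_antisymm, hc, map_neg]
    rw [mul_comm F, star_X_mul, ih, ham_X_mul, ham_X_mul, hc, hc', C_mul', C_mul']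
    simp only [map_add, map_smul, LinearMap.add_apply, LinearMap.smul_apply, star_X_mul, ih,
      mul_sub, mul_add, smul_add, smul_sub, mul_smul_comm, mul_left_comm (X t) (X s), neg_smul,
      map_neg, smul_neg]
    abel

lemma star_one (F : Poly K n) : star K n F 1 = F := by
  induction F using MvPolynomial.induction_on with
  | C a => rw [star_C, C_eq_smul_one]
  | add F F' hF hF' => simp only [map_add, LinearMap.add_apply, hF, hF']
  | mul_X F s ih => rw [mul_comm, star_X_mul, ih]; simp

lemma X_star (s : Fin n ⊕ Fin n) (G : Poly K n) :
    star K n (X s) G = X s * G + (2⁻¹ : K) • ham s G := by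
  simpa [one_star] using star_X_mul s 1 G

lemma star_X (s : Fin n ⊕ Fin n) (F : Poly K n) :
    star K n F (X s) = X s * F - (2⁻¹ : K) • ham s F := by
  simpa [star_one] using star_mul_X s F 1

end

section

/-! ### Homogeneous components and the parity automorphism -/

lemma monomial_mem_homPart (u : Fin n ⊕ Fin n →₀ ℕ) :
    (monomial u 1 : Poly K n) ∈ homPart K n u.degree :=
  isHomogeneous_monomial 1 rfl

/-- Linear maps on `S` agree as soon as they agree on homogeneous elements. -/
lemma linearMap_ext_homPart {M : Type*} [AddCommGroup M] [Module K M] {φ ψ : Poly K n →ₗ[K] M}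
    (h : ∀ f, ∀ F ∈ homPart K n f, φ F = ψ F) : φ = ψ := by
  refine LinearMap.ext fun F => ?_
  rw [← sum_homogeneousComponent F, map_sum, map_sum]
  exact Finset.sum_congr rfl fun f _ => h f _ (homogeneousComponent_isHomogeneous f F)

/-- The parity automorphism of `S`, which acts on `S^f` as `(-1)^f`. -/
def parity : Poly K n →ₐ[K] Poly K n := aeval fun s => -X s

lemma parity_of_mem {f : ℕ} {F : Poly K n} (hF : F ∈ homPart K n f) :
    parity F = (-1 : K) ^ f • F := by
  rw [F.as_sum, map_sum, Finset.smul_sum]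
  refine Finset.sum_congr rfl fun u hu => ?_
  have hu' : ∑ s ∈ u.support, u s = f := by
    have := hF (mem_support_iff.mp hu)
    rw [← Finsupp.degree_apply, ← this, Finsupp.degree_eq_weight_one]; rfl
  rw [parity, aeval_monomial, Finsupp.prod]
  simp only [neg_pow (X _ : Poly K n)]
  rw [Finset.prod_mul_distrib, Finset.prod_pow_eq_pow_sum, hu', prod_X_pow_eq_monomial,
    algebraMap_eq, mul_left_comm, C_mul_monomial, mul_one, ← C_mul', map_pow, map_neg, map_one]

lemma parity_X_mul (s : Fin n ⊕ Fin n) (F : Poly K n) :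
    parity (X s * F) = -(X s * parity F) := by
  simp [parity]

lemma parity_ham (s : Fin n ⊕ Fin n) (F : Poly K n) : parity (ham s F) = -ham s (parity F) := by
  induction F using MvPolynomial.induction_on with
  | C a => simp [parity]
  | add F F' hF hF' => simp only [map_add, hF, hF', neg_add]
  | mul_X F t ih =>
    obtain ⟨c, hc⟩ := exists_ham_X_eq_C (K := K) s t
    have hC : parity (n := n) (C c) = C c := by simp [parity]
    rw [mul_comm, ham_X_mul, map_add, map_mul, hc, parity_X_mul, parity_X_mul, ih, map_neg,
      ham_X_mul, hc, hC]
    ring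

lemma str_parity (F : Poly K n) : str K n (parity F) = str K n F := by
  have : (aeval (R := K) (fun _ : Fin n ⊕ Fin n => (0 : K))).comp (parity (K := K)) =
      aeval (R := K) (fun _ : Fin n ⊕ Fin n => (0 : K)) :=
    MvPolynomial.algHom_ext fun s => by simp [parity]
  exact DFunLike.congr_fun this F

lemma str_X_mul (s : Fin n ⊕ Fin n) (F : Poly K n) : str K n (X s * F) = 0 := by
  simp [str]

lemma str_C (c : K) : str K n (C c) = c := by
  simp [str]

lemma eq_C_of_mem_homPart_zero {F : Poly K n} (hF : F ∈ homPart K n 0) : ∃ c, F = C c :=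
  ⟨_, totalDegree_eq_zero_iff_eq_C.mp ((totalDegree_zero_iff_isHomogeneous _).mpr hF)⟩

lemma str_of_mem {f : ℕ} {F : Poly K n} (hF : F ∈ homPart K n f) (hf : f ≠ 0) :
    str K n F = 0 := by
  have h : coeff 0 F = 0 := by
    by_contra h
    exact hf (by simpa using (hF h).symm)
  simpa [str, constantCoeff_eq] using h

lemma kappa_apply (F G : Poly K n) : kappa K n F G = str K n (star K n F G) := rfl

lemma kappa_C (c : K) (G : Poly K n) : kappa K n (C c) G = c * str K n G := by
  rw [kappa_apply, star_C, map_smul, smul_eq_mul]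

variable [CharZero K]

lemma parity_star (F G : Poly K n) :
    parity (star K n F G) = star K n (parity F) (parity G) := by
  induction F using MvPolynomial.induction_on generalizing G with
  | C a =>
    have : parity (n := n) (C a) = C a := by simp [parity]
    rw [this, star_C, star_C, map_smul]
  | add F F' hF hF' => simp only [map_add, LinearMap.add_apply, hF, hF']
  | mul_X F s ih =>
    rw [mul_comm, star_X_mul, map_add, map_smul, parity_X_mul, parity_X_mul, ih, ih, parity_ham]
    simp only [map_neg, LinearMap.neg_apply, star_X_mul, smul_neg, neg_add]

/-! ### The form `κ` -/

lemma kappa_one_right (F : Poly K n) : kappa K n F 1 = str K n F := by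
  rw [kappa_apply, star_one]

/-- Up to the factor `1/2`, multiplication by a generator is left adjoint to its Hamiltonian
derivation. -/
lemma kappa_X_mul (s : Fin n ⊕ Fin n) (F G : Poly K n) :
    kappa K n (X s * F) G = 2⁻¹ * kappa K n F (ham s G) := by
  rw [kappa_apply, star_X_mul, map_add, str_X_mul, zero_add, map_smul, smul_eq_mul, kappa_apply]

lemma kappa_mul_X (s : Fin n ⊕ Fin n) (F G : Poly K n) :
    kappa K n F (X s * G) = -(2⁻¹ * kappa K n (ham s F) G) := by
  rw [kappa_apply, star_mul_X, map_sub, str_X_mul, zero_sub, map_smul, smul_eq_mul, kappa_apply]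

lemma kappa_star_left (F G H : Poly K n) :
    kappa K n (star K n F G) H = kappa K n F (star K n G H) := by
  rw [kappa_apply, kappa_apply, star_assoc]

/-- The supertrace property of `F ↦ F(0)`. -/
lemma kappa_parity_left (F G : Poly K n) :
    kappa K n (parity F) G = kappa K n G F := by
  induction F using MvPolynomial.induction_on generalizing G with
  | C a =>
    have : parity (n := n) (C a) = C a := by simp [parity]
    rw [this, kappa_C, C_eq_smul_one, map_smul, kappa_one_right, smul_eq_mul]
  | add F F' hF hF' => simp only [map_add, LinearMap.add_apply, hF, hF']
  | mul_X F s ih =>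
    rw [mul_comm, parity_X_mul, kappa_mul_X, ← ih, map_neg, LinearMap.neg_apply, kappa_X_mul]

lemma kappa_parity_parity (F G : Poly K n) :
    kappa K n (parity F) (parity G) = kappa K n F G := by
  rw [kappa_apply, ← parity_star, str_parity, kappa_apply]

lemma kappa_eq_zero_of_ne {f g : ℕ} (hfg : f ≠ g) {F G : Poly K n} (hF : F ∈ homPart K n f)
    (hG : G ∈ homPart K n g) : kappa K n F G = 0 := by
  induction f generalizing F G g with
  | zero =>
    obtain ⟨c, rfl⟩ := eq_C_of_mem_homPart_zero hF
    rw [kappa_C, str_of_mem hG hfg.symm, mul_zero]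
  | succ f ih =>
    -- By Euler's identity `F` is a combination of products `X s * ∂F/∂x_s`.
    have hE : ((f + 1 : ℕ) : K) * kappa K n F G = 0 := by
      rw [← smul_eq_mul, ← LinearMap.smul_apply, ← map_smul, Nat.cast_smul_eq_nsmul,
        ← IsHomogeneous.sum_X_mul_pderiv hF, map_sum, LinearMap.sum_apply]
      refine Finset.sum_eq_zero fun s _ => ?_
      rw [kappa_X_mul]
      rcases g with _ | g
      · obtain ⟨c, rfl⟩ := eq_C_of_mem_homPart_zero hG
        simp
      · rw [ih (g := g) (by omega) (IsHomogeneous.pderiv hF) (ham_mem_homPart hG s), mul_zero]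
    exact (mul_eq_zero.mp hE).resolve_left (by exact_mod_cast f.succ_ne_zero)

/-- A homogeneous element in the left kernel of `κ` vanishes: by `kappa_mul_X` the kernel is stable
under the Hamiltonian derivations, so by induction on the degree they all kill the element, and
Euler's identity applies. -/
lemma eq_zero_of_kappa_eq_zero {f : ℕ} {F : Poly K n} (hF : F ∈ homPart K n f)
    (h : ∀ G, kappa K n F G = 0) : F = 0 := by
  induction f generalizing F with
  | zero =>
    obtain ⟨c, rfl⟩ := eq_C_of_mem_homPart_zero hF
    have := h 1
    rw [kappa_one_right, str_C] at this
    rw [this, map_zero]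
  | succ f ih =>
    have hham : ∀ s, ham s F = 0 := fun s =>
      ih (ham_mem_homPart hF s) fun G => by
        have := h (X s * G)
        rw [kappa_mul_X] at this
        simpa using this
    have hd : ∀ s, pderiv s F = 0 := by
      rintro (i | i)
      · simpa using hham (Sum.inr i)
      · simpa using hham (Sum.inl i)
    have hE := IsHomogeneous.sum_X_mul_pderiv hF
    simp only [hd, mul_zero, Finset.sum_const_zero] at hE
    exact (smul_eq_zero.mp hE.symm).resolve_left f.succ_ne_zero

/-! ### The form `B` -/

/-- A formula without signs depending on degrees: since `κ(S^f, S^g) = 0` for `f ≠ g`, the sign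
`(-1)^{fg+1}` may be replaced by `(-1)^{f+1}`. -/
lemma formB_eq (F G : Poly K n) : formB K n F G = -kappa K n (parity F) G := by
  have : formB K n = -(kappa K n ∘ₗ (parity (K := K)).toLinearMap) := by
    refine linearMap_ext_homPart fun f F hF => linearMap_ext_homPart fun g G hG => ?_
    rw [formB_apply hF hG]
    simp only [LinearMap.neg_apply, LinearMap.comp_apply, AlgHom.toLinearMap_apply,
      parity_of_mem hF, map_smul, LinearMap.smul_apply, smul_eq_mul]
    rcases eq_or_ne f g with rfl | hfg
    · rw [pow_succ, pow_mul]
      rcases f.even_or_odd with h | h <;> simp [h.neg_one_pow]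
    · simp [kappa_eq_zero_of_ne hfg hF hG]
  rw [this]
  rfl

lemma formB_eq_zero_of_ne {f g : ℕ} (hfg : f ≠ g) {F G : Poly K n} (hF : F ∈ homPart K n f)
    (hG : G ∈ homPart K n g) : formB K n F G = 0 := by
  rw [formB_apply hF hG, kappa_eq_zero_of_ne hfg hF hG, mul_zero]

lemma formB_isSupersymmetric : IsSupersymmetric (formB K n) := by
  intro f g F G hF hG
  rcases eq_or_ne f g with rfl | hfg
  · rw [formB_eq, formB_eq, kappa_parity_left, parity_of_mem hG, map_smul, LinearMap.smul_apply,
      smul_eq_mul, mul_neg, ← mul_assoc, pow_mul, ← mul_pow]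
    rcases f.even_or_odd with h | h <;> simp [h.neg_one_pow]
  · rw [formB_eq_zero_of_ne hfg hF hG, formB_eq_zero_of_ne hfg.symm hG hF, mul_zero]

/-- Each restriction of `B` to `S^f` has trivial left kernel. -/
lemma eq_zero_of_formB_eq_zero {f : ℕ} {F : Poly K n} (hF : F ∈ homPart K n f)
    (h : ∀ G ∈ homPart K n f, formB K n F G = 0) : F = 0 := by
  refine eq_zero_of_kappa_eq_zero hF fun G => ?_
  have : kappa K n F = 0 := linearMap_ext_homPart fun g G hG => by
    rcases eq_or_ne f g with rfl | hfg
    · have := h G hG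
      rw [formB_apply hF hG] at this
      simpa using this
    · simpa using kappa_eq_zero_of_ne hfg hF hG
  rw [this, LinearMap.zero_apply]

lemma formB_swap (F G : Poly K n) : formB K n F G = formB K n G (parity F) := by
  rw [formB_eq, formB_eq, kappa_parity_left, kappa_parity_parity]

lemma formB_restrict_nondegenerate (f : ℕ) :
    ((formB K n).restrict (homPart K n f)).Nondegenerate := by
  refine ⟨fun F h => Subtype.ext (eq_zero_of_formB_eq_zero F.2 fun G hG => h ⟨G, hG⟩),
    fun F h => Subtype.ext (eq_zero_of_formB_eq_zero F.2 fun G hG => ?_)⟩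
  have : formB K n G F = 0 := h ⟨G, hG⟩
  rw [formB_isSupersymmetric f f F G F.2 hG, this, mul_zero]

lemma formB_separatingLeft : (formB K n).SeparatingLeft := by
  intro F h
  have hc : ∀ f, homogeneousComponent f F = 0 := fun f => by
    refine eq_zero_of_formB_eq_zero (homogeneousComponent_isHomogeneous f F) fun G hG => ?_
    by_cases hf : f ∈ Finset.range (F.totalDegree + 1)
    · rw [← h G]
      conv_rhs => rw [← sum_homogeneousComponent F, map_sum, LinearMap.sum_apply]
      rw [Finset.sum_eq_single_of_mem f hf]
      exact fun g _ hg => formB_eq_zero_of_ne hg (homogeneousComponent_isHomogeneous g F) hG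
    · rw [homogeneousComponent_eq_zero _ _ (by simpa using hf), map_zero, LinearMap.zero_apply]
  rw [← sum_homogeneousComponent F]
  exact Finset.sum_eq_zero fun f _ => hc f

lemma formB_nondegenerate : (formB K n).Nondegenerate := by
  refine ⟨formB_separatingLeft, fun G h => formB_separatingLeft G fun F => ?_⟩
  have : formB K n G = 0 := linearMap_ext_homPart fun f F hF => by
    have h1 := h F
    rw [formB_swap, parity_of_mem hF, map_smul] at h1
    simpa using h1
  rw [this, LinearMap.zero_apply]

/-- The form `B` is `ad'`-invariant: writing `B(F, G) = -κ(εF, G)` with `ε` the parity automorphism,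
this follows from `κ(F ⋆ G, H) = κ(F, G ⋆ H)` and `κ(εF, G) = κ(G, F)`. -/
lemma formB_isAdTwistedInvariant : IsAdTwistedInvariant (formB K n) := by
  intro a f A F G hA hF
  suffices h : formB K n (adTwisted K n A F) +
      (-1 : K) ^ (a * f) • (formB K n F ∘ₗ adTwisted K n A) = 0 from LinearMap.congr_fun h G
  refine linearMap_ext_homPart fun g G hG => ?_
  have hcyc : kappa K n F (star K n G A) = (-1) ^ a * kappa K n (star K n A F) G := by
    rw [← kappa_star_left, ← kappa_parity_left, parity_of_mem hA, map_smul, LinearMap.smul_apply,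
      smul_eq_mul, kappa_star_left]
  have hpar : kappa K n (star K n A F) G =
      (-1) ^ (a + f + g) * kappa K n (star K n A F) G := by
    conv_lhs => rw [← kappa_parity_parity, parity_star, parity_of_mem hA, parity_of_mem hF,
      parity_of_mem hG]
    simp only [map_smul, LinearMap.smul_apply, smul_eq_mul]
    ring
  simp only [LinearMap.add_apply, LinearMap.smul_apply, LinearMap.comp_apply, LinearMap.zero_apply,
    smul_eq_mul, adTwisted_apply hA hF, adTwisted_apply hA hG, formB_eq, map_sub, map_smul,
    LinearMap.sub_apply, parity_star, parity_of_mem hA, parity_of_mem hF, hcyc, kappa_star_left F A G]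
  generalize kappa K n F (star K n A G) = y
  generalize kappa K n (star K n A F) G = x at hpar ⊢
  rcases (a + f + g).even_or_odd with h | h
  · rcases a.even_or_odd with ha | ha <;> rcases f.even_or_odd with hf | hf <;>
      rcases g.even_or_odd with hg | hg <;>
      first
      | (exfalso; revert h; rw [imp_false, Nat.not_even_iff_odd]; grind)
      | (simp [pow_add, pow_mul, ha.neg_one_pow, hf.neg_one_pow, hg.neg_one_pow]; done)
      | (simp [pow_add, pow_mul, ha.neg_one_pow, hf.neg_one_pow, hg.neg_one_pow]; ring)
  · rw [h.neg_one_pow, neg_one_mul, self_eq_neg] at hpar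
    have haa : (-1 : K) ^ a * (-1) ^ a = 1 := by simp [← mul_pow]
    rw [hpar]
    linear_combination (y * (-1) ^ f * (-1) ^ (a * f)) * haa

end

section

/-! ### Uniqueness of the invariant form -/

/-- The twisted adjoint action of an even element is the commutator. -/
lemma adTwisted_of_even {a : ℕ} (ha : Even a) {A : Poly K n} (hA : A ∈ homPart K n a)
    (G : Poly K n) : adTwisted K n A G = star K n A G - star K n G A := by
  suffices h : adTwisted K n A = star K n A - (star K n).flip A from LinearMap.congr_fun h G
  refine linearMap_ext_homPart fun g G hG => ?_
  rw [adTwisted_apply hA hG, (ha.mul_right _).neg_one_pow, one_smul]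
  rfl

variable [CharZero K]

/-- Hamiltonian derivations of generators hit every monomial, since the characteristic is zero. -/
lemma exists_ham_eq_monomial (s : Fin n ⊕ Fin n) (u : Fin n ⊕ Fin n →₀ ℕ) :
    ∃ F ∈ homPart K n (u.degree + 1), ham s F = monomial u 1 := by
  have key : ∀ t, ∃ F ∈ homPart K n (u.degree + 1), pderiv t F = monomial u 1 := fun t => by
    refine ⟨((u t + 1 : ℕ) : K)⁻¹ • monomial (u + Finsupp.single t 1) 1,
      Submodule.smul_mem _ _ (isHomogeneous_monomial _ (by simp)), ?_⟩
    have : ((u t + 1 : ℕ) : K) ≠ 0 := by exact_mod_cast (u t).succ_ne_zero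
    rw [Derivation.map_smul, pderiv_monomial, smul_monomial]
    congr 1
    · simp
    · simpa using inv_mul_cancel₀ this
  rcases s with i | i
  · exact key (Sum.inr i)
  · obtain ⟨F, hF, h⟩ := key (Sum.inl i)
    exact ⟨-F, neg_mem hF, by simpa using h⟩

lemma adTwisted_X_of_odd (s : Fin n ⊕ Fin n) {f : ℕ} (hf : Odd f) {F : Poly K n}
    (hF : F ∈ homPart K n f) : adTwisted K n (X s) F = ham s F := by
  rw [adTwisted_apply (f := 1) (isHomogeneous_X K s) hF, one_mul, hf.add_one.neg_one_pow, one_smul,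
    X_star, star_X, add_sub_sub_cancel, ← add_smul]
  norm_num

lemma adTwisted_X_mul_X (s : Fin n ⊕ Fin n) (G : Poly K n) :
    adTwisted K n (X s * X s) G = (2 : K) • (X s * ham s G) := by
  rw [adTwisted_of_even even_two (IsHomogeneous.mul (isHomogeneous_X K s) (isHomogeneous_X K s)),
    star_X_mul, star_mul_X, X_star, X_star, star_X, star_X, two_smul]
  simp only [mul_add, mul_sub, mul_smul_comm, smul_add, smul_sub]
  have e : ∀ v : Poly K n, v = (2⁻¹ : K) • v + (2⁻¹ : K) • v := fun v => by
    rw [← add_smul]; norm_num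
  conv_rhs => rw [e (X s * ham s G)]
  abel

lemma adTwisted_one_of_odd {a : ℕ} (ha : Odd a) {A : Poly K n} (hA : A ∈ homPart K n a) :
    adTwisted K n A 1 = (2 : K) • A := by
  rw [adTwisted_apply (g := 0) hA (isHomogeneous_one _ _), zero_add, mul_one, ha.neg_one_pow,
    star_one, one_star, neg_one_smul, sub_neg_eq_add, two_smul]

variable {b : LinearMap.BilinForm K (Poly K n)}

/-- For an invariant form `b`, the functional `b(1, ·)` is a multiple of evaluation at `0`: it
kills `ad'(A)(G)` for even `A`, hence all monomials `X s * ∂G` (take `A = X s ^ 2`). -/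
lemma IsAdTwistedInvariant.apply_one (hb : IsAdTwistedInvariant b) (h : b 1 1 = 0) :
    b 1 = 0 := by
  refine (basisMonomials _ K).ext fun u => ?_
  rw [coe_basisMonomials, LinearMap.zero_apply]
  rcases eq_or_ne u 0 with rfl | hu
  · exact h
  obtain ⟨s, hs⟩ := Finsupp.ne_iff.mp hu
  obtain ⟨G, -, hG⟩ := exists_ham_eq_monomial (K := K) s (u - Finsupp.single s 1)
  have hX : (monomial u 1 : Poly K n) = X s * ham s G := by
    rw [hG, X, monomial_mul, one_mul, add_tsub_cancel_of_le]
    exact Finsupp.single_le_iff.mpr (Nat.one_le_iff_ne_zero.mpr hs)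
  have hA : (X s * X s : Poly K n) ∈ homPart K n 2 :=
    IsHomogeneous.mul (isHomogeneous_X K s) (isHomogeneous_X K s)
  have := hb 2 0 _ 1 G hA (isHomogeneous_one _ _)
  rw [adTwisted_of_even even_two hA 1, star_one, one_star, sub_self, map_zero,
    LinearMap.zero_apply, zero_add, adTwisted_X_mul_X, map_smul, ← hX] at this
  simpa using this

lemma IsAdTwistedInvariant.apply_odd (hb : IsAdTwistedInvariant b) (h : b 1 1 = 0) {a : ℕ}
    (ha : Odd a) {A : Poly K n} (hA : A ∈ homPart K n a) : b A = 0 := by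
  refine LinearMap.ext fun G => ?_
  have := hb a 0 A 1 G hA (isHomogeneous_one _ _)
  rw [adTwisted_one_of_odd ha hA, hb.apply_one h] at this
  simpa using this

/-- An invariant form is determined by its value at `(1, 1)`. -/
lemma IsAdTwistedInvariant.eq_zero (hb : IsAdTwistedInvariant b) (h : b 1 1 = 0) : b = 0 := by
  refine (basisMonomials _ K).ext fun u => ?_
  rw [coe_basisMonomials, LinearMap.zero_apply]
  rcases u.degree.even_or_odd with hu | hu
  · rcases eq_or_ne u 0 with rfl | hu0
    · exact hb.apply_one h
    -- A non-constant even monomial is `ad'(X s)(F)` for an odd `F`.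
    obtain ⟨s, -⟩ := Finsupp.ne_iff.mp hu0
    obtain ⟨F, hF, hFu⟩ := exists_ham_eq_monomial (K := K) s u
    refine LinearMap.ext fun G => ?_
    have := hb 1 _ (X s) F G (isHomogeneous_X K s) hF
    rw [adTwisted_X_of_odd s hu.add_one hF, hFu, hb.apply_odd h hu.add_one hF] at this
    simpa using this
  · exact hb.apply_odd h hu (monomial_mem_homPart u)

lemma IsAdTwistedInvariant.exists_eq_smul_formB (hb : IsAdTwistedInvariant b) :
    ∃ β : K, b = β • formB K n := by
  refine ⟨-b 1 1, sub_eq_zero.mp (IsAdTwistedInvariant.eq_zero ?_ ?_)⟩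
  · intro a f A F G hA hF
    have h1 := hb a f A F G hA hF
    have h2 := formB_isAdTwistedInvariant a f A F G hA hF
    simp only [LinearMap.sub_apply, LinearMap.smul_apply, smul_eq_mul]
    linear_combination h1 + b 1 1 * h2
  · have : formB K n 1 1 = -1 := by
      rw [formB_eq, map_one parity, kappa_one_right]
      simpa using str_C (n := n) (1 : K)
    simp [this]

end

end Moyal

end

theorem theorem4p4 (K : Type*) [Field K] [CharZero K] (n : ℕ) :
    (∀ (f g : ℕ) (F G : Moyal.Poly K n), F ∈ Moyal.homPart K n f → G ∈ Moyal.homPart K n g →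
      Moyal.formB K n F G = (-1) ^ (f * g + 1) * Moyal.kappa K n F G) ∧
    (Moyal.formB K n).Nondegenerate ∧
    Moyal.IsSupersymmetric (Moyal.formB K n) ∧
    (∀ (l m : ℕ), l ≠ m → ∀ (F G : Moyal.Poly K n), F ∈ Moyal.homPart K n l → G ∈ Moyal.homPart K n m →
      Moyal.formB K n F G = 0) ∧
    (∀ l : ℕ, ((Moyal.formB K n).restrict (Moyal.homPart K n l)).Nondegenerate) ∧
    Moyal.IsAdTwistedInvariant (Moyal.formB K n) ∧
    (∀ B' : LinearMap.BilinForm K (Moyal.Poly K n), Moyal.IsAdTwistedInvariant B' →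
      ∃ β : K, B' = β • Moyal.formB K n) := by
  exact ⟨fun _ _ _ _ hF hG => Moyal.formB_apply hF hG, Moyal.formB_nondegenerate,
    Moyal.formB_isSupersymmetric, fun _ _ hlm _ _ hF hG => Moyal.formB_eq_zero_of_ne hlm hF hG,
    Moyal.formB_restrict_nondegenerate, Moyal.formB_isAdTwistedInvariant,
    fun _ hb => hb.exists_eq_smul_formB⟩
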